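/- Let $X$ be a Polish space, let $d\in\mathbb N$, and let $G$ be a $d$-regular bipartite Borel graph on $X$, i.e. a simple graph with vertex set $X$ whose edge relation is a Borel subset of $X\times X$, all of whose vertices have degree $d$, and which admits a (not necessarily Borel) proper $2$-coloring. Suppose that $G$ is one-ended: for every connected component $C$ of $G$ and every finite $F\subseteq C$, the subgraph of $G$ induced on $C\setminus F$ has exactly one infinite connected component. Then $G$ has a Borel perfect matching generically: there is a comeagre Borel set $Y\subseteq X$ that is $G$-invariant (a union of connected components of $G$), together with a perfect matching $M$ of the induced subgraph $G|_Y$ (a set of edges of $G|_Y$ such that every vertex of $Y$ lies in exactly one of them) whose edge relation is a Borel subset of $Y\times Y$. -/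

import Mathlib

/-- A Borel graph: the edge relation is a Borel subset of `X × X`. -/
def SimpleGraph.IsBorel {X : Type*} [MeasurableSpace X] (G : SimpleGraph X) : Prop :=
  MeasurableSet {p : X × X | G.Adj p.1 p.2}

/-- One-endedness of a connected graph: deleting any finite set of vertices leaves exactly one
infinite connected component. -/
def SimpleGraph.HasOneEnd {V : Type*} (H : SimpleGraph V) : Prop :=
  ∀ F : Set V, F.Finite → ∃! D : (H.induce Fᶜ).ConnectedComponent, D.supp.Infinite

/-- A graph, connected or not, is one-ended if each of its connected components is. -/
def SimpleGraph.IsOneEnded {V : Type*} (G : SimpleGraph V) : Prop :=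
  ∀ C : G.ConnectedComponent, C.toSimpleGraph.HasOneEnd

/-- A `G`-invariant set of vertices: a union of connected components of `G`. -/
def SimpleGraph.IsInvariantSet {V : Type*} (G : SimpleGraph V) (Y : Set V) : Prop :=
  ∀ ⦃x y : V⦄, G.Reachable x y → x ∈ Y → y ∈ Y

/-- A Borel perfect matching of `G`: a perfect matching whose edge relation is Borel. -/
def SimpleGraph.HasBorelPerfectMatching {X : Type*} [MeasurableSpace X]
    (G : SimpleGraph X) : Prop :=
  ∃ M : G.Subgraph, M.IsPerfectMatching ∧ MeasurableSet {p : X × X | M.Adj p.1 p.2}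

/-! Integer weights on the edges with sum `d` at each vertex are `d` times a fractional perfect
matching, and a perfect matching when all weights are `0` or `d`; call the other edges fractional.
Start from weight one everywhere. If the fractional graph is almost one-ended, it has no bridge: a
finite side would, by a sum signed by the 2-colouring, force `d` to divide the weight of the bridge
(`not_finite_of_unique_frac_boundary`), and two infinite sides contradict one-endedness. So every
fractional edge lies on a cycle, of even length, along which weight can be shifted by alternating
units. Finitely many shifts settle a given vertex, and weights `0` and `d` never change.

To do this in a Borel way, such a change is recorded by a finite code on a window. There are
countably many codes, so by Baire category a single code, used in disjoint windows, serves
nonmeagrely many points of a given open set (`exists_refines_not_isMeagre`). This may change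
infinitely many edges of one component; almost one-endedness survives because the boundary of each
window stays joined by fractional edges inside it (`exists_window`, `patch_almostOneEnded`).
Treating all pairs of an orbit map and a basic open set in turn settles every vertex of comeagrely
many components. The colouring serves only to prove that codes exist, so it need not be Borel. -/

namespace SimpleGraph

open Finset

variable {X : Type*}

/-! ### A form of one-endedness that survives refinement -/

/-- Within each connected component of `G`, a vertex set with finite edge boundary in `H` either
contains or misses all but finitely many of the vertices with infinite `H`-component. -/
def AlmostOneEnded (G H : SimpleGraph X) : Prop :=
  ∀ (x : X) (S : Set X),
    {p : X × X | G.Reachable x p.1 ∧ H.Adj p.1 p.2 ∧ p.1 ∈ S ∧ p.2 ∉ S}.Finite →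
    {v | G.Reachable x v ∧ {w | H.Reachable v w}.Infinite ∧ v ∈ S}.Finite ∨
    {v | G.Reachable x v ∧ {w | H.Reachable v w}.Infinite ∧ v ∉ S}.Finite

theorem AlmostOneEnded.mono_of_finite_diff {G H H' : SimpleGraph X} (h : AlmostOneEnded G H)
    (hle : H' ≤ H) (hfin : {p : X × X | H.Adj p.1 p.2 ∧ ¬ H'.Adj p.1 p.2}.Finite) :
    AlmostOneEnded G H' := by
  intro x S hS
  have hinf : ∀ v, {w | H'.Reachable v w}.Infinite → {w | H.Reachable v w}.Infinite :=
    fun v hv => hv.mono fun w hw => Reachable.mono hle hw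
  refine (h x S ((hS.union hfin).subset ?_)).imp (fun hf => hf.subset ?_)
    (fun hf => hf.subset ?_)
  · rintro p ⟨h1, h2, h3, h4⟩
    by_cases h' : H'.Adj p.1 p.2
    · exact Or.inl ⟨h1, h', h3, h4⟩
    · exact Or.inr ⟨h2, h'⟩
  · rintro v ⟨h1, h2, h3⟩
    exact ⟨h1, hinf v h2, h3⟩
  · rintro v ⟨h1, h2, h3⟩
    exact ⟨h1, hinf v h2, h3⟩

/-- Two vertices of the same component of `G` with infinite `H`-components are joined in `H`. -/
theorem AlmostOneEnded.reachable {G H : SimpleGraph X} (h : AlmostOneEnded G H) (hle : H ≤ G)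
    {x u v : X} (hu : G.Reachable x u) (hv : G.Reachable x v)
    (hui : {w | H.Reachable u w}.Infinite) (hvi : {w | H.Reachable v w}.Infinite) :
    H.Reachable u v := by
  by_contra huv
  have hinf : ∀ a b, H.Reachable a b → {w | H.Reachable a w}.Infinite →
      {w | H.Reachable b w}.Infinite := fun a b hab ha => ha.mono fun w hw => hab.symm.trans hw
  -- No edge of `H` leaves the `H`-component of `u`, so its boundary is empty.
  rcases h x {w | H.Reachable u w} (by
    convert Set.finite_empty
    ext p
    simp only [Set.mem_ofPred_eq, Set.mem_empty_iff_false, iff_false]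
    rintro ⟨-, h2, h3, h4⟩
    exact h4 (h3.trans h2.reachable)) with hf | hf
  · exact hui (hf.subset fun w hw => ⟨hu.trans (Reachable.mono hle hw), hinf _ _ hw hui, hw⟩)
  · refine hvi (hf.subset fun w hw => ⟨hv.trans (Reachable.mono hle hw), hinf _ _ hw hvi, ?_⟩)
    exact fun h' => huv (Reachable.trans h' (Reachable.symm hw))

/-! ### Unit flows along walks -/

section Flow

variable {H : SimpleGraph X}

open scoped Classical in
/-- The unit flow along a walk: traversals of `(a, b)` minus traversals of `(b, a)`. -/
noncomputable def Walk.flow : {u v : X} → H.Walk u v → X → X → ℤ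
  | _, _, .nil => fun _ _ => 0
  | u, _, .cons (v := w) _ p => fun a b =>
      (if a = u ∧ b = w then 1 else 0) - (if a = w ∧ b = u then 1 else 0) + p.flow a b

open scoped Classical in
theorem Walk.flow_swap {u v : X} (p : H.Walk u v) (a b : X) : p.flow b a = - p.flow a b := by
  induction p with
  | nil => simp [Walk.flow]
  | @cons u w v h p ih =>
    have hcomm : ∀ c e, (if b = c ∧ a = e then (1 : ℤ) else 0) = if a = e ∧ b = c then 1 else 0 :=
      fun c e => if_congr and_comm rfl rfl
    simp only [Walk.flow, ih, hcomm]
    ring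

theorem Walk.flow_eq_zero {u v : X} (p : H.Walk u v) {a b : X} (h : s(a, b) ∉ p.edges) :
    p.flow a b = 0 := by
  induction p with
  | nil => simp [Walk.flow]
  | cons h' p ih =>
    simp only [Walk.edges_cons, List.mem_cons, not_or, Sym2.eq_iff] at h
    simp only [Walk.flow]
    rw [ih h.2, if_neg h.1.1, if_neg h.1.2]
    simp

theorem Walk.IsTrail.abs_flow_le {u v : X} {p : H.Walk u v} (hp : p.IsTrail) (a b : X) :
    |p.flow a b| ≤ 1 := by
  induction p with
  | nil => simp [Walk.flow]
  | cons h' p ih =>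
    rw [Walk.isTrail_cons] at hp
    simp only [Walk.flow]
    by_cases hab : s(a, b) ∈ p.edges
    · have hne : ∀ {c e}, s(c, e) ∉ p.edges → ¬ (a = c ∧ b = e) := by
        rintro c e hce ⟨rfl, rfl⟩
        exact hce hab
      rw [if_neg (hne hp.2), if_neg (hne (by rw [Sym2.eq_swap]; exact hp.2))]
      simpa using ih hp.1
    · rw [Walk.flow_eq_zero p hab]
      split_ifs <;> simp

open scoped Classical in
theorem Walk.sum_flow {G : SimpleGraph X} [G.LocallyFinite] (hle : H ≤ G) {u v : X}
    (p : H.Walk u v) (a : X) :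
    ∑ b ∈ G.neighborFinset a, p.flow a b = (if a = u then 1 else 0) - (if a = v then 1 else 0) := by
  induction p with
  | nil => simp [Walk.flow]
  | @cons u w v h p ih =>
    have aux : ∀ c e, G.Adj c e →
        ∑ b ∈ G.neighborFinset a, (if a = c ∧ b = e then (1 : ℤ) else 0) =
          if a = c then 1 else 0 := by
      intro c e hce
      by_cases hac : a = c
      · subst hac
        simp [Finset.sum_ite_eq', hce]
      · simp [hac]
    simp only [Walk.flow, Finset.sum_add_distrib, Finset.sum_sub_distrib, ih]
    rw [aux u w (hle h), aux w u (hle h).symm]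
    ring

end Flow

/-! ### Integer weightings and shifts along cycles -/

/-- A nonnegative integer weighting of the edges of `G` with total weight `d` at every vertex;
dividing by `d` gives a fractional perfect matching. -/
structure Weighting (G : SimpleGraph X) [G.LocallyFinite] (d : ℕ) where
  val : X → X → ℤ
  symm : ∀ a b, val a b = val b a
  adj_of_ne : ∀ a b, val a b ≠ 0 → G.Adj a b
  nonneg : ∀ a b, 0 ≤ val a b
  sum_eq : ∀ a, ∑ b ∈ G.neighborFinset a, val a b = d

namespace Weighting

variable {G : SimpleGraph X} [G.LocallyFinite] {d : ℕ}

theorem le (φ : G.Weighting d) (a b : X) : φ.val a b ≤ d := by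
  by_cases h : φ.val a b = 0
  · simp [h]
  · rw [← φ.sum_eq a]
    exact Finset.single_le_sum (f := fun b => φ.val a b) (fun b _ => φ.nonneg a b)
      (by simpa using φ.adj_of_ne a b h)

/-- The graph of edges whose weight is neither `0` nor `d`. -/
def frac (φ : G.Weighting d) : SimpleGraph X where
  Adj a b := φ.val a b ≠ 0 ∧ φ.val a b ≠ d
  symm := ⟨fun a b h => by rwa [φ.symm b a]⟩
  loopless := ⟨fun a h => G.loopless.irrefl a (φ.adj_of_ne a a h.1)⟩

theorem frac_le (φ : G.Weighting d) : φ.frac ≤ G := fun a b h => φ.adj_of_ne a b h.1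

theorem frac_bounds (φ : G.Weighting d) {a b : X} (h : φ.frac.Adj a b) :
    0 < φ.val a b ∧ φ.val a b < d :=
  ⟨lt_of_le_of_ne (φ.nonneg a b) h.1.symm, lt_of_le_of_ne (φ.le a b) h.2⟩

/-- `ψ` keeps the weight of every edge that has weight `0` or `d` in `φ`. -/
def Refines (ψ φ : G.Weighting d) : Prop := ∀ a b, ¬ φ.frac.Adj a b → ψ.val a b = φ.val a b

theorem Refines.refl (φ : G.Weighting d) : φ.Refines φ := fun _ _ _ => rfl

theorem Refines.frac_le {ψ φ : G.Weighting d} (h : ψ.Refines φ) : ψ.frac ≤ φ.frac := by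
  intro a b hab
  by_contra hn
  have := h a b hn
  exact hn ⟨this ▸ hab.1, this ▸ hab.2⟩

theorem Refines.trans {χ ψ φ : G.Weighting d} (h : χ.Refines ψ) (h' : ψ.Refines φ) :
    χ.Refines φ := fun a b hab => by
  rw [h a b (fun hh => hab (h'.frac_le hh)), h' a b hab]

/-- All edges at `x` have weight `0` or `d`. -/
def Settled (φ : G.Weighting d) (x : X) : Prop := ∀ y, ¬ φ.frac.Adj x y

theorem Settled.of_refines {ψ φ : G.Weighting d} (h : ψ.Refines φ) {x : X} (hx : φ.Settled x) :
    ψ.Settled x := fun y hy => hx y (h.frac_le hy)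

theorem settled_of_val_eq (φ : G.Weighting d) {x y : X} (h : φ.val x y = d) :
    φ.Settled x := by
  classical
  intro z hz
  by_cases hzy : z = y
  · subst hzy; exact hz.2 h
  · have hb := φ.frac_bounds hz
    have hy : y ∈ G.neighborFinset x := by
      simp only [mem_neighborFinset]
      apply φ.adj_of_ne
      rw [h]
      have := φ.le x z
      omega
    have := Finset.add_sum_erase _ (fun b => φ.val x b) hy
    have h2 := Finset.single_le_sum (f := fun b => φ.val x b) (s := (G.neighborFinset x).erase y)
      (fun b _ => φ.nonneg x b) (a := z) (by simpa [hzy] using φ.frac_le hz)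
    have h3 := φ.sum_eq x
    omega

/-- A finite set of vertices is not left by exactly one edge of fractional weight. -/
theorem not_finite_of_unique_frac_boundary (φ : G.Weighting d) {sgn : X → ℤ}
    (hsgn : ∀ a, sgn a = 1 ∨ sgn a = -1) (hadj : ∀ a b, G.Adj a b → sgn b = - sgn a)
    {S : Set X} {u v : X} (huv : φ.frac.Adj u v) (hu : u ∈ S) (hv : v ∉ S)
    (huniq : ∀ a b, φ.frac.Adj a b → a ∈ S → b ∉ S → a = u ∧ b = v) : ¬ S.Finite := by
  classical
  intro hS
  lift S to Finset X using hS
  simp only [Finset.mem_coe] at *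
  -- Edges inside `S` cancel in the signed sum because their ends have opposite signs. Of the
  -- boundary edges only `uv` can have a weight other than `0` and `d`, so `d` divides that weight
  -- too.
  have h1 : ∑ a ∈ S, ∑ b ∈ G.neighborFinset a, sgn a * φ.val a b = d * ∑ a ∈ S, sgn a := by
    rw [Finset.mul_sum]
    refine Finset.sum_congr rfl fun a _ => ?_
    rw [← Finset.mul_sum, φ.sum_eq, mul_comm]
  have h2 : ∑ a ∈ S, ∑ b ∈ S, sgn a * φ.val a b = 0 := by
    have : ∑ a ∈ S, ∑ b ∈ S, sgn a * φ.val a b = - ∑ a ∈ S, ∑ b ∈ S, sgn a * φ.val a b := by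
      conv_lhs => rw [Finset.sum_comm]
      rw [← Finset.sum_neg_distrib]
      refine Finset.sum_congr rfl fun a _ => ?_
      rw [← Finset.sum_neg_distrib]
      refine Finset.sum_congr rfl fun b _ => ?_
      by_cases h : φ.val a b = 0
      · simp [h, φ.symm b a]
      · rw [hadj a b (φ.adj_of_ne a b h), φ.symm b a]
        ring
    omega
  have h3 : ∀ a ∈ S, ∑ b ∈ S, sgn a * φ.val a b =
      ∑ b ∈ (G.neighborFinset a).filter (· ∈ S), sgn a * φ.val a b := by
    intro a _
    refine (Finset.sum_subset (fun b hb => (Finset.mem_filter.1 hb).2) fun b hb hb' => ?_).symm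
    by_contra hne
    refine hb' (Finset.mem_filter.2 ⟨?_, hb⟩)
    simpa using φ.adj_of_ne a b (right_ne_zero_of_mul hne)
  have h4 : ∑ a ∈ S, ∑ b ∈ (G.neighborFinset a).filter (· ∉ S), sgn a * φ.val a b =
      d * ∑ a ∈ S, sgn a := by
    rw [← h1, ← sub_eq_zero, ← neg_sub, neg_eq_zero, ← h2, ← Finset.sum_sub_distrib]
    refine Finset.sum_congr rfl fun a ha => ?_
    rw [h3 a ha, ← Finset.sum_filter_add_sum_filter_not (G.neighborFinset a) (· ∈ S)]
    ring
  have hdvd : ∀ a b, a ∈ S → b ∉ S → ¬ (a = u ∧ b = v) → (d : ℤ) ∣ sgn a * φ.val a b := by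
    intro a b ha hb hne
    have : ¬ φ.frac.Adj a b := fun h => hne (huniq a b h ha hb)
    have h' : φ.val a b = 0 ∨ φ.val a b = d := by
      by_contra hcon
      exact this (not_or.1 hcon)
    rcases h' with h' | h' <;> simp [h']
  have h5 : (d : ℤ) ∣ sgn u * φ.val u v := by
    have hu' : (d : ℤ) ∣ ∑ b ∈ (G.neighborFinset u).filter (· ∉ S), sgn u * φ.val u b := by
      rw [← Finset.add_sum_erase _ _ hu] at h4
      refine (Int.dvd_iff_dvd_of_dvd_add (h4 ▸ dvd_mul_right _ _)).2
        (Finset.dvd_sum fun a ha => Finset.dvd_sum fun b hb => ?_)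
      rw [Finset.mem_erase] at ha
      exact hdvd a b ha.2 (Finset.mem_filter.1 hb).2 (fun h => ha.1 h.1)
    have hv' : v ∈ (G.neighborFinset u).filter (· ∉ S) := by
      simpa [hv] using φ.frac_le huv
    rw [← Finset.add_sum_erase _ _ hv'] at hu'
    refine (Int.dvd_iff_dvd_of_dvd_add hu').2 (Finset.dvd_sum fun b hb => ?_)
    rw [Finset.mem_erase] at hb
    exact hdvd u b hu (Finset.mem_filter.1 hb.2).2 (fun h => hb.1 h.2)
  have h6 : (d : ℤ) ∣ φ.val u v := by
    rcases hsgn u with h | h <;> simpa [h] using h5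
  have := φ.frac_bounds huv
  have := Int.le_of_dvd this.1 h6
  omega

/-- If `uv` were a bridge, each side would be left by a single fractional edge and hence be
infinite; but the side of `u` has finite boundary, so one of the two sides must be finite. -/
theorem not_isBridge (φ : G.Weighting d) {sgn : X → ℤ}
    (hsgn : ∀ a, sgn a = 1 ∨ sgn a = -1) (hadj : ∀ a b, G.Adj a b → sgn b = - sgn a)
    (hend : AlmostOneEnded G φ.frac) {u v : X} (huv : φ.frac.Adj u v) :
    (φ.frac.deleteEdges {s(u, v)}).Reachable v u := by
  by_contra hcon
  set K := φ.frac.deleteEdges {s(u, v)} with hK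
  have hKle : K ≤ φ.frac := deleteEdges_le _
  have hstep : ∀ a b, φ.frac.Adj a b → s(a, b) ≠ s(u, v) → K.Reachable a b := fun a b hab hne =>
    Adj.reachable (by rw [hK, deleteEdges_adj]; exact ⟨hab, hne⟩)
  have key : ∀ a b t, φ.frac.Adj a b → K.Reachable t a → ¬ K.Reachable t b →
      (a = u ∧ b = v) ∨ (a = v ∧ b = u) := by
    intro a b t hab ha hb
    by_contra hne
    exact hb (ha.trans (hstep a b hab (by simpa using hne)))
  have hS : ¬ {w | K.Reachable u w}.Finite := by
    refine φ.not_finite_of_unique_frac_boundary hsgn hadj huv (Reachable.refl u)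
      (fun h => hcon (Reachable.symm h)) fun a b hab ha hb => ?_
    rcases key a b u hab ha hb with h | h
    · exact h
    · exact absurd (h.2 ▸ Reachable.refl u) hb
  have hT : ¬ {w | K.Reachable v w}.Finite := by
    refine φ.not_finite_of_unique_frac_boundary hsgn hadj huv.symm (Reachable.refl v)
      hcon fun a b hab ha hb => ?_
    rcases key a b v hab ha hb with h | h
    · exact absurd (h.2 ▸ Reachable.refl v) hb
    · exact h
  have hmem : ∀ t w, φ.frac.Reachable u t → ¬ {w | K.Reachable t w}.Finite → K.Reachable t w →
      G.Reachable u w ∧ {z | φ.frac.Reachable w z}.Infinite := by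
    intro t w hut ht hw
    exact ⟨(hut.trans (Reachable.mono hKle hw)).mono φ.frac_le, Set.Infinite.mono (fun z hz =>
      Reachable.mono hKle (hw.symm.trans hz)) ht⟩
  rcases hend u {w | K.Reachable u w} ((Set.finite_singleton (u, v)).subset (by
    rintro ⟨a, b⟩ ⟨-, h2, h3, h4⟩
    rcases key a b u h2 h3 h4 with h | h
    · simp [h.1, h.2]
    · exact absurd (h.2 ▸ Reachable.refl u) h4)) with hf | hf
  · exact hS (hf.subset fun w hw =>
      let h := hmem u w (Reachable.refl u) hS hw
      ⟨h.1, h.2, hw⟩)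
  · exact hT (hf.subset fun w hw =>
      let h := hmem v w huv.reachable hT hw
      ⟨h.1, h.2, fun h' => hcon (Reachable.trans hw (Reachable.symm h'))⟩)

/-- The weight of a fractional edge can be raised by one, shifting weight along a cycle. -/
theorem exists_increment (φ : G.Weighting d) {sgn : X → ℤ}
    (hsgn : ∀ a, sgn a = 1 ∨ sgn a = -1) (hadj : ∀ a b, G.Adj a b → sgn b = - sgn a)
    (hend : AlmostOneEnded G φ.frac) {u v : X} (huv : φ.frac.Adj u v) :
    ∃ ψ : G.Weighting d, ψ.Refines φ ∧ ψ.val u v = φ.val u v + 1 ∧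
      {p : X × X | ψ.val p.1 p.2 ≠ φ.val p.1 p.2}.Finite ∧
      ∀ a b, ψ.val a b ≠ φ.val a b → G.Reachable u a := by
  classical
  have hcyc := φ.not_isBridge hsgn hadj hend huv
  set K := φ.frac.deleteEdges {s(u, v)} with hK
  obtain ⟨p, hp⟩ := hcyc.exists_isPath
  have hKle : K ≤ φ.frac := deleteEdges_le _
  have huvp : s(u, v) ∉ p.edges := fun h => by
    have := p.edges_subset_edgeSet h
    simp [hK] at this
  let q : φ.frac.Walk u u := Walk.cons huv (p.mapLe hKle)
  have hq : q.IsTrail := by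
    rw [Walk.isTrail_cons]
    exact ⟨hp.isTrail.mapLe hKle, by simpa [Walk.edges_mapLe_eq_edges] using huvp⟩
  -- The flow is antisymmetric and `sgn` alternates along edges, so `δ` is symmetric; it sums to
  -- zero at each vertex because `q` is closed. The factor `sgn u` makes `δ u v = 1`.
  let δ : X → X → ℤ := fun a b => sgn u * sgn a * q.flow a b
  have hz : ∀ a b, s(a, b) ∉ q.edges → δ a b = 0 := fun a b h => by
    simp [δ, q.flow_eq_zero h]
  have hz' : ∀ a b, ¬ φ.frac.Adj a b → δ a b = 0 := fun a b h =>
    hz a b fun h' => h (q.edges_subset_edgeSet h')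
  have habs : ∀ a b, |δ a b| ≤ 1 := fun a b => by
    have := hq.abs_flow_le a b
    rcases hsgn u with h | h <;> rcases hsgn a with h' | h' <;> simpa [δ, h, h'] using this
  have hb : ∀ a b, 0 ≤ φ.val a b + δ a b := fun a b => by
    by_cases h : φ.frac.Adj a b
    · have := φ.frac_bounds h
      have := abs_le.1 (habs a b)
      omega
    · rw [hz' a b h]; simpa using φ.nonneg a b
  refine ⟨⟨fun a b => φ.val a b + δ a b, fun a b => ?_, fun a b h => ?_, hb, fun a => ?_⟩,
    fun a b h => by simp [hz' a b h], ?_, ?_, ?_⟩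
  · by_cases h : φ.frac.Adj a b
    · simp only [δ]
      rw [φ.symm, q.flow_swap a b, hadj a b (φ.frac_le h)]
      ring
    · rw [hz' a b h, hz' b a (fun h' => h h'.symm), φ.symm]
  · by_cases h' : φ.frac.Adj a b
    · exact φ.frac_le h'
    · exact φ.adj_of_ne a b (by simpa [hz' a b h'] using h)
  · rw [Finset.sum_add_distrib, φ.sum_eq]
    simp only [δ]
    rw [← Finset.mul_sum, q.sum_flow φ.frac_le]
    simp
  · have h0 : (p.mapLe hKle).flow u v = 0 := Walk.flow_eq_zero _ (by
      simpa [Walk.edges_mapLe_eq_edges] using huvp)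
    have hne : u ≠ v := huv.ne
    have hq1 : q.flow u v = 1 := by
      simp only [q, Walk.flow, h0]
      simp [hne]
    simp only [δ, hq1]
    rcases hsgn u with h | h <;> simp [h]
  · refine ((q.support.toFinset ×ˢ q.support.toFinset).finite_toSet).subset ?_
    rintro ⟨a, b⟩ hab
    have : s(a, b) ∈ q.edges := by
      by_contra h
      exact hab (by simp [hz a b h])
    simpa using ⟨q.fst_mem_support_of_mem_edges this, q.snd_mem_support_of_mem_edges this⟩
  · intro a b hab
    have : s(a, b) ∈ q.edges := by
      by_contra h
      exact hab (by simp [hz a b h])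
    exact ((q.takeUntil a (q.fst_mem_support_of_mem_edges this)).reachable).mono φ.frac_le

theorem almostOneEnded_frac_of_finite {φ ψ : G.Weighting d} (h : AlmostOneEnded G φ.frac)
    (href : ψ.Refines φ) (hfin : {p : X × X | ψ.val p.1 p.2 ≠ φ.val p.1 p.2}.Finite) :
    AlmostOneEnded G ψ.frac :=
  h.mono_of_finite_diff href.frac_le (hfin.subset fun p hp hne => hp.2 (by
    have := hp.1
    simpa [frac, hne] using this))

/-- Finitely many changes of weight settle a given vertex. -/
theorem exists_settled (φ : G.Weighting d) {sgn : X → ℤ}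
    (hsgn : ∀ a, sgn a = 1 ∨ sgn a = -1) (hadj : ∀ a b, G.Adj a b → sgn b = - sgn a)
    (hend : AlmostOneEnded G φ.frac) (x : X) :
    ∃ ψ : G.Weighting d, ψ.Refines φ ∧ ψ.Settled x ∧
      {p : X × X | ψ.val p.1 p.2 ≠ φ.val p.1 p.2}.Finite ∧
      ∀ a b, ψ.val a b ≠ φ.val a b → G.Reachable x a := by
  by_cases hx : φ.Settled x
  · exact ⟨φ, Refines.refl φ, hx, by simp, by simp⟩
  simp only [Settled, not_forall, not_not] at hx
  obtain ⟨y, hy⟩ := hx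
  -- The weight of `xy` reaches `d` only at the last increment, so `xy` is still fractional before
  -- each one. Weight `d` on `xy` leaves nothing for the other edges at `x`.
  have key : ∀ n : ℕ, (φ.val x y + n ≤ d) → ∃ ψ : G.Weighting d, ψ.Refines φ ∧
      ψ.val x y = φ.val x y + n ∧
      {p : X × X | ψ.val p.1 p.2 ≠ φ.val p.1 p.2}.Finite ∧
      ∀ a b, ψ.val a b ≠ φ.val a b → G.Reachable x a := by
    intro n
    induction n with
    | zero => exact fun _ => ⟨φ, Refines.refl φ, by simp, by simp, by simp⟩
    | succ n ih =>
      intro hn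
      push_cast at hn
      obtain ⟨ψ, h1, h2, h3, h4⟩ := ih (by omega)
      have hb := φ.frac_bounds hy
      obtain ⟨χ, k1, k2, k3, k4⟩ := ψ.exists_increment hsgn hadj
        (almostOneEnded_frac_of_finite hend h1 h3) (u := x) (v := y)
        ⟨by omega, by omega⟩
      refine ⟨χ, k1.trans h1, by rw [k2, h2]; push_cast; ring, (h3.union k3).subset ?_, ?_⟩
      · intro p hp
        by_cases h : ψ.val p.1 p.2 = φ.val p.1 p.2
        · exact Or.inr (fun h' => hp (h'.trans h))
        · exact Or.inl h
      · intro a b hab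
        by_cases h : ψ.val a b = φ.val a b
        · exact k4 a b (h ▸ hab)
        · exact h4 a b h
  have hb := φ.frac_bounds hy
  obtain ⟨ψ, h1, h2, h3, h4⟩ := key (d - φ.val x y).toNat (by omega)
  exact ⟨ψ, h1, ψ.settled_of_val_eq (y := y) (by omega), h3, h4⟩

/-! ### Windows with a connected boundary -/

/-- A finite window around a finite change of weights, whose boundary is held together by
fractional edges inside the window. -/
theorem exists_window {φ ψ : G.Weighting d} (hend : AlmostOneEnded G φ.frac)
    (href : ψ.Refines φ) (hfin : {p : X × X | ψ.val p.1 p.2 ≠ φ.val p.1 p.2}.Finite) (x : X)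
    (hreach : ∀ a b, ψ.val a b ≠ φ.val a b → G.Reachable x a) :
    ∃ W : Finset X, x ∈ W ∧ (∀ y, φ.frac.Adj x y → y ∈ W) ∧ (∀ w ∈ W, G.Reachable x w) ∧
      (∀ a b, ψ.val a b ≠ φ.val a b → a ∈ W ∧ b ∈ W) ∧
      ∀ S : Set X, (∀ a ∈ W, ∀ b ∈ W, ψ.frac.Adj a b → a ∈ S → b ∈ S) →
        ∀ a ∈ W, ∀ b ∈ W, (∃ t ∉ W, φ.frac.Adj a t) → (∃ t ∉ W, φ.frac.Adj b t) →
          a ∈ S → b ∈ S := by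
  classical
  have hend' := almostOneEnded_frac_of_finite hend href hfin
  let W₀ : Finset X := insert x (G.neighborFinset x) ∪ hfin.toFinset.image Prod.fst
  have hW₀r : ∀ w ∈ W₀, G.Reachable x w := by
    intro w hw
    simp only [W₀, Finset.mem_union, Finset.mem_insert, mem_neighborFinset, Finset.mem_image,
      Set.Finite.mem_toFinset, Set.mem_ofPred_eq, Prod.exists, exists_and_right,
      exists_eq_right] at hw
    rcases hw with (rfl | hw) | ⟨b, hb⟩
    · exact Reachable.refl _
    · exact hw.reachable
    · exact hreach w b hb
  have hW₀ : ∀ a b, ψ.val a b ≠ φ.val a b → a ∈ W₀ := fun a b h => by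
    refine Finset.mem_union_right _ (Finset.mem_image.2 ⟨(a, b), by simpa using h, rfl⟩)
  -- All infinite `ψ.frac`-components meeting `W₀` coincide. The window absorbs the finite
  -- components whole and joins the other points of `W₀` to one base point `w₀` by walks.
  have hcomp : ∃ w₀ : X, ∀ w ∈ W₀, ∃ P : Finset X, w ∈ P ∧
      (({z | ψ.frac.Reachable w z}.Finite ∧ ∀ z, z ∈ P ↔ ψ.frac.Reachable w z) ∨
       ({z | ψ.frac.Reachable w z}.Infinite ∧
        ∃ p : ψ.frac.Walk w₀ w, ∀ z, z ∈ P ↔ z ∈ p.support)) := by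
    by_cases hI : ∃ w₀ ∈ W₀, {z | ψ.frac.Reachable w₀ z}.Infinite
    · obtain ⟨w₀, hw₀, hi₀⟩ := hI
      refine ⟨w₀, fun w hw => ?_⟩
      by_cases hw' : {z | ψ.frac.Reachable w z}.Finite
      · exact ⟨hw'.toFinset, by simp, Or.inl ⟨hw', by simp⟩⟩
      · obtain ⟨p⟩ := hend'.reachable ψ.frac_le (hW₀r w₀ hw₀) (hW₀r w hw) hi₀ hw'
        exact ⟨p.support.toFinset, by simp, Or.inr ⟨hw', p, by simp⟩⟩
    · push Not at hI
      refine ⟨x, fun w hw => ⟨(hI w hw).toFinset, by simp,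
        Or.inl ⟨hI w hw, by simp⟩⟩⟩
  obtain ⟨w₀, hP⟩ := hcomp
  choose! P hPself hP using hP
  refine ⟨W₀.biUnion P, ?_, ?_, ?_, ?_, ?_⟩
  · exact Finset.mem_biUnion.2 ⟨x, by simp [W₀], hPself x (by simp [W₀])⟩
  · intro y hy
    have : y ∈ W₀ := by simp [W₀, φ.frac_le hy]
    exact Finset.mem_biUnion.2 ⟨y, this, hPself y this⟩
  · intro w hw
    obtain ⟨c, hc, hw⟩ := Finset.mem_biUnion.1 hw
    rcases hP c hc with ⟨-, h⟩ | ⟨-, p, h⟩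
    · exact (hW₀r c hc).trans (((h w).1 hw).mono ψ.frac_le)
    · exact (hW₀r c hc).trans
        (((p.dropUntil w ((h w).1 hw)).reachable.symm).mono ψ.frac_le)
  · intro a b hab
    have ha := hW₀ a b hab
    have hb := hW₀ b a (by rwa [ψ.symm, φ.symm])
    exact ⟨Finset.mem_biUnion.2 ⟨a, ha, hPself a ha⟩, Finset.mem_biUnion.2 ⟨b, hb, hPself b hb⟩⟩
  · intro S hS
    have hS' : ∀ a ∈ W₀.biUnion P, ∀ b ∈ W₀.biUnion P, ψ.frac.Adj a b → (a ∈ S ↔ b ∈ S) :=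
      fun a ha b hb hab => ⟨hS a ha b hb hab, hS b hb a ha hab.symm⟩
    have hwalk : ∀ (u v : X) (p : ψ.frac.Walk u v), (∀ z ∈ p.support, z ∈ W₀.biUnion P) →
        (u ∈ S ↔ v ∈ S) := by
      intro u v p
      induction p with
      | nil => simp
      | cons h p ih =>
        intro hz
        simp only [Walk.support_cons, List.mem_cons, forall_eq_or_imp] at hz
        exact (hS' _ hz.1 _ (hz.2 _ p.start_mem_support) h).trans (ih hz.2)
    have hmain : ∀ a ∈ W₀.biUnion P, (∃ t ∉ W₀.biUnion P, φ.frac.Adj a t) →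
        (w₀ ∈ S ↔ a ∈ S) := by
      rintro a ha ⟨t, ht, hat⟩
      -- The edge to `t` leaves the window, so it is unchanged. Hence `a` is not in an absorbed
      -- finite component, which would contain `t`, and must lie on a walk from `w₀`.
      have hat' : ψ.frac.Adj a t := by
        have : ψ.val a t = φ.val a t := by
          by_contra hne
          have h' := hW₀ t a (by rwa [ψ.symm, φ.symm])
          exact ht (Finset.mem_biUnion.2 ⟨t, h', hPself t h'⟩)
        exact ⟨this ▸ hat.1, this ▸ hat.2⟩
      obtain ⟨c, hc, hac⟩ := Finset.mem_biUnion.1 ha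
      rcases hP c hc with ⟨-, h⟩ | ⟨-, p, h⟩
      · exact absurd (Finset.mem_biUnion.2
          ⟨c, hc, (h t).2 (((h a).1 hac).trans hat'.reachable)⟩) ht
      · refine hwalk _ _ (p.takeUntil a ((h a).1 hac)) fun z hz => ?_
        exact Finset.mem_biUnion.2 ⟨c, hc, (h z).2 (p.support_takeUntil_subset_support _ hz)⟩
    intro a ha b hb hat hbt haS
    exact (hmain b hb hbt).1 ((hmain a ha hat).2 haS)

end Weighting

end SimpleGraph

/-! ### Coding a local change of weights by finite data -/

namespace SimpleGraph

open Finset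

variable {X : Type*}

namespace Weighting

variable {G : SimpleGraph X} [G.LocallyFinite] {d : ℕ}

theorem sum_eq_sum_of_support {f : X → ℤ} {s t : Finset X} (hs : ∀ b, f b ≠ 0 → b ∈ s)
    (ht : ∀ b, f b ≠ 0 → b ∈ t) : ∑ b ∈ s, f b = ∑ b ∈ t, f b := by
  rw [← finsum_eq_sum_of_support_subset f (s := s) (fun b hb => hs b hb),
    ← finsum_eq_sum_of_support_subset f (s := t) (fun b hb => ht b hb)]

variable {ι : Type*} {T : ι → X → X}

/-- The maps `T (a p)` embed `Fin n` as a window around `y`, the maps `T (r p)` lead back from the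
window to `y`, and replacing the weights inside the window by `M` settles `y` without
disconnecting the boundary of the window. -/
structure Fits (T : ι → X → X) (φ : G.Weighting d) {n : ℕ} (a r : Fin n → ι)
    (M : Fin n → Fin n → ℤ) (y : X) : Prop where
  inj : ∀ p q, T (a p) y = T (a q) y → p = q
  ret : ∀ p, T (r p) (T (a p) y) = y
  symm : ∀ p q, M p q = M q p
  nonneg : ∀ p q, 0 ≤ M p q
  keep : ∀ p q, ¬ φ.frac.Adj (T (a p) y) (T (a q) y) → M p q = φ.val (T (a p) y) (T (a q) y)
  sum : ∀ p, ∑ q, M p q = ∑ q, φ.val (T (a p) y) (T (a q) y)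
  center : ∃ p, T (a p) y = y ∧ (∀ q, M p q = 0 ∨ M p q = d) ∧
    ∀ i, φ.frac.Adj y (T i y) → ∃ q, T (a q) y = T i y
  tight : ∀ S : Finset (Fin n), (∀ p q, M p q ≠ 0 → M p q ≠ d → p ∈ S → q ∈ S) → ∀ p q,
    (∃ i, (∀ q', T (a q') y ≠ T i y) ∧ φ.frac.Adj (T (a p) y) (T i y)) →
    (∃ i, (∀ q', T (a q') y ≠ T i y) ∧ φ.frac.Adj (T (a q) y) (T i y)) → p ∈ S → q ∈ S

/-- The signs are spent here: the resulting code no longer mentions them. -/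
theorem exists_fits (hT : ∀ x y, G.Reachable x y ↔ ∃ i, T i x = y) (φ : G.Weighting d)
    {sgn : X → ℤ} (hsgn : ∀ a, sgn a = 1 ∨ sgn a = -1)
    (hadj : ∀ a b, G.Adj a b → sgn b = - sgn a) (hend : AlmostOneEnded G φ.frac) (y : X) :
    ∃ (n : ℕ) (a r : Fin n → ι) (M : Fin n → Fin n → ℤ), Fits T φ a r M y := by
  classical
  obtain ⟨ψ, href, hset, hfin, hreach⟩ := φ.exists_settled hsgn hadj hend y
  obtain ⟨W, hyW, hnb, hWr, hsupp, htight⟩ := exists_window hend href hfin y hreach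
  let e : Fin W.card ≃ W := W.equivFin.symm
  have ha : ∀ p, ∃ i, T i y = e p := fun p => (hT _ _).1 (hWr _ (e p).2)
  choose a ha using ha
  have hr : ∀ p, ∃ i, T i (e p : X) = y := fun p => (hT _ _).1 (hWr _ (e p).2).symm
  choose r hr using hr
  have hes : ∀ w ∈ W, ∃ p, (e p : X) = w := fun w hw => ⟨e.symm ⟨w, hw⟩, by simp⟩
  have hout : ∀ {i}, (∀ q', T (a q') y ≠ T i y) → T i y ∉ W := by
    intro i h hi
    obtain ⟨q, hq⟩ := hes _ hi
    exact h q (by rw [ha, hq])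
  refine ⟨W.card, a, r, fun p q => ψ.val (e p) (e q), ?_⟩
  constructor
  · intro p q h
    rw [ha, ha] at h
    exact e.injective (Subtype.ext h)
  · intro p
    rw [ha, hr]
  · exact fun p q => ψ.symm _ _
  · exact fun p q => ψ.nonneg _ _
  · intro p q h
    rw [ha, ha] at h ⊢
    exact href _ _ h
  · intro p
    simp only [ha]
    have hsum : ∀ f : X → ℤ, ∑ q, f (e q) = ∑ w ∈ W, f w := fun f => by
      rw [← Finset.sum_coe_sort W]
      exact e.sum_comp (fun w => f w)
    rw [hsum (fun w => ψ.val (e p) w), hsum (fun w => φ.val (e p) w), ← sub_eq_zero,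
      ← Finset.sum_sub_distrib,
      sum_eq_sum_of_support (t := G.neighborFinset (e p)), Finset.sum_sub_distrib, ψ.sum_eq,
      φ.sum_eq, sub_self]
    · exact fun b hb => (hsupp _ _ (sub_ne_zero.1 hb)).2
    · intro b hb
      rw [mem_neighborFinset]
      by_contra hn
      have h1 : ψ.val (e p) b = 0 := by
        by_contra h
        exact hn (ψ.adj_of_ne _ _ h)
      have h2 : φ.val (e p) b = 0 := by
        by_contra h
        exact hn (φ.adj_of_ne _ _ h)
      exact hb (by rw [h1, h2, sub_self])
  · obtain ⟨p, hp⟩ := hes y hyW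
    refine ⟨p, by rw [ha, hp], fun q => ?_, fun i hi => ?_⟩
    · by_contra hcon
      exact hset _ (hp ▸ not_or.1 hcon)
    · obtain ⟨q, hq⟩ := hes _ (hnb _ hi)
      exact ⟨q, by rw [ha, hq]⟩
  · rintro S hS p q ⟨i, hi, hpi⟩ ⟨j, hj, hqj⟩ hpS
    rw [ha] at hpi hqj
    have := htight ((fun p => (e p : X)) '' S) ?_ _ (e p).2 _ (e q).2 ⟨_, hout hi, hpi⟩
      ⟨_, hout hj, hqj⟩ ⟨p, hpS, rfl⟩
    · obtain ⟨q', hq', h⟩ := this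
      rwa [← e.injective (Subtype.ext h)]
    · rintro _ - b hb hab ⟨p', hp', rfl⟩
      obtain ⟨q', rfl⟩ := hes b hb
      exact ⟨q', hS p' q' hab.1 hab.2 hp', rfl⟩

/-! ### Simultaneous changes in disjoint windows -/

section Patch

variable {φ : G.Weighting d} {n : ℕ} {a r : Fin n → ι} {M : Fin n → Fin n → ℤ} {A : Set X}

open scoped Classical in
/-- The weights `M` transported to the windows around the points of `A`. -/
noncomputable def patchVal (T : ι → X → X) (φ : G.Weighting d) (a : Fin n → ι)
    (M : Fin n → Fin n → ℤ) (A : Set X) (u v : X) : ℤ :=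
  if h : ∃ k : Fin n × Fin n, ∃ y ∈ A, T (a k.1) y = u ∧ T (a k.2) y = v then
    M h.choose.1 h.choose.2
  else φ.val u v

/-- Disjointness of the windows and injectivity of `p ↦ T (a p) y` make the choice in `patchVal`
unique. -/
theorem patchVal_of_mem (hfit : ∀ y ∈ A, Fits T φ a r M y)
    (hdisj : ∀ y ∈ A, ∀ y' ∈ A, ∀ p q, T (a p) y = T (a q) y' → y = y')
    {y : X} (hy : y ∈ A) (p q : Fin n) :
    patchVal T φ a M A (T (a p) y) (T (a q) y) = M p q := by
  have h : ∃ k : Fin n × Fin n, ∃ y' ∈ A, T (a k.1) y' = T (a p) y ∧ T (a k.2) y' = T (a q) y :=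
    ⟨(p, q), y, hy, rfl, rfl⟩
  rw [patchVal, dif_pos h]
  obtain ⟨y', hy', h1, h2⟩ := h.choose_spec
  obtain rfl := hdisj _ hy' _ hy _ _ h1
  rw [(hfit _ hy).inj _ _ h1, (hfit _ hy).inj _ _ h2]

theorem patchVal_of_not {u v : X} (h : ∀ y ∈ A, ∀ p q, T (a p) y = u → T (a q) y ≠ v) :
    patchVal T φ a M A u v = φ.val u v := by
  rw [patchVal, dif_neg]
  rintro ⟨k, y, hy, h1, h2⟩
  exact h y hy _ _ h1 h2

theorem patchVal_of_not_frac (hfit : ∀ y ∈ A, Fits T φ a r M y)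
    (hdisj : ∀ y ∈ A, ∀ y' ∈ A, ∀ p q, T (a p) y = T (a q) y' → y = y')
    {u v : X} (h : ¬ φ.frac.Adj u v) : patchVal T φ a M A u v = φ.val u v := by
  by_cases hw : ∃ y ∈ A, ∃ p q, T (a p) y = u ∧ T (a q) y = v
  · obtain ⟨y, hy, p, q, rfl, rfl⟩ := hw
    rw [patchVal_of_mem hfit hdisj hy]
    exact (hfit y hy).keep p q h
  · exact patchVal_of_not fun y hy p q h1 h2 => hw ⟨y, hy, p, q, h1, h2⟩

/-- Replace the weights by `M` in disjoint windows around the points of `A`. -/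
noncomputable def patch (hfit : ∀ y ∈ A, Fits T φ a r M y)
    (hdisj : ∀ y ∈ A, ∀ y' ∈ A, ∀ p q, T (a p) y = T (a q) y' → y = y') : G.Weighting d where
  val := patchVal T φ a M A
  symm u v := by
    by_cases hw : ∃ y ∈ A, ∃ p q, T (a p) y = u ∧ T (a q) y = v
    · obtain ⟨y, hy, p, q, rfl, rfl⟩ := hw
      rw [patchVal_of_mem hfit hdisj hy, patchVal_of_mem hfit hdisj hy, (hfit y hy).symm]
    · rw [patchVal_of_not fun y hy p q h1 h2 => hw ⟨y, hy, p, q, h1, h2⟩,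
        patchVal_of_not fun y hy p q h1 h2 => hw ⟨y, hy, q, p, h2, h1⟩, φ.symm]
  adj_of_ne u v h := by
    by_contra hn
    have h0 : φ.val u v = 0 := by
      by_contra h
      exact hn (φ.adj_of_ne _ _ h)
    rw [patchVal_of_not_frac hfit hdisj (fun h' => h'.1 h0)] at h
    exact h h0
  nonneg u v := by
    by_cases hw : ∃ y ∈ A, ∃ p q, T (a p) y = u ∧ T (a q) y = v
    · obtain ⟨y, hy, p, q, rfl, rfl⟩ := hw
      rw [patchVal_of_mem hfit hdisj hy]
      exact (hfit y hy).nonneg p q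
    · rw [patchVal_of_not fun y hy p q h1 h2 => hw ⟨y, hy, p, q, h1, h2⟩]
      exact φ.nonneg u v
  sum_eq u := by
    classical
    rw [← φ.sum_eq u, ← sub_eq_zero, ← Finset.sum_sub_distrib]
    by_cases hw : ∃ y ∈ A, ∃ p, T (a p) y = u
    · obtain ⟨y, hy, p, rfl⟩ := hw
      rw [sum_eq_sum_of_support (t := Finset.univ.image fun q => T (a q) y),
        Finset.sum_image fun q _ q' _ h => (hfit y hy).inj q q' h, Finset.sum_sub_distrib,
        sub_eq_zero, ← (hfit y hy).sum p]
      · exact Finset.sum_congr rfl fun q _ => patchVal_of_mem hfit hdisj hy p q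
      · intro b hb
        rw [mem_neighborFinset]
        by_contra hn
        exact hb (sub_eq_zero.2 (patchVal_of_not_frac hfit hdisj fun h => hn (φ.frac_le h)))
      · intro b hb
        by_contra hn
        refine hb (sub_eq_zero.2 (patchVal_of_not fun y' hy' p' q' h1 h2 => hn ?_))
        obtain rfl := hdisj _ hy' _ hy _ _ h1
        exact Finset.mem_image.2 ⟨q', Finset.mem_univ _, h2⟩
    · refine Finset.sum_eq_zero fun b _ => sub_eq_zero.2 (patchVal_of_not ?_)
      exact fun y hy p q h1 _ => hw ⟨y, hy, p, h1⟩

variable (hfit : ∀ y ∈ A, Fits T φ a r M y)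
  (hdisj : ∀ y ∈ A, ∀ y' ∈ A, ∀ p q, T (a p) y = T (a q) y' → y = y')

theorem patch_refines : (patch hfit hdisj).Refines φ :=
  fun _ _ h => patchVal_of_not_frac hfit hdisj h

theorem patch_settled (hT : ∀ x y, G.Reachable x y ↔ ∃ i, T i x = y) {y : X} (hy : y ∈ A) :
    (patch hfit hdisj).Settled y := by
  intro z hz
  have hz' := (patch_refines hfit hdisj).frac_le hz
  obtain ⟨p, hp, hM, hnb⟩ := (hfit y hy).center
  obtain ⟨i, rfl⟩ := (hT y z).1 (φ.frac_le hz').reachable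
  obtain ⟨q, hq⟩ := hnb i hz'
  have h : (patch hfit hdisj).val y (T i y) = M p q := by
    have := patchVal_of_mem hfit hdisj hy p q
    rwa [hp, hq] at this
  rcases hM q with h' | h'
  · exact hz.1 (h.trans h')
  · exact hz.2 (h.trans h')

/-- The vertex `T (a p) y` of the window around `y` is joined by a fractional edge to a vertex
outside the window. -/
def IsOuter (T : ι → X → X) (φ : G.Weighting d) (a : Fin n → ι) (y : X) (p : Fin n) : Prop :=
  ∃ t, (∀ q, T (a q) y ≠ t) ∧ φ.frac.Adj (T (a p) y) t

/-- No fractional edge inside the window around `y` leaves `S`. -/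
def IsPure (T : ι → X → X) (φ : G.Weighting d) (a : Fin n → ι) (S : Set X) (y : X) : Prop :=
  ∀ p q, φ.frac.Adj (T (a p) y) (T (a q) y) → T (a p) y ∈ S → T (a q) y ∈ S

theorem patch_outer_iff (hT : ∀ x y, G.Reachable x y ↔ ∃ i, T i x = y) {S : Set X} {y : X}
    (hy : y ∈ A) (hpure : IsPure T (patch hfit hdisj) a S y) {p q : Fin n}
    (hp : IsOuter T φ a y p) (hq : IsOuter T φ a y q) :
    T (a p) y ∈ S ↔ T (a q) y ∈ S := by
  classical
  have key : ∀ p, IsOuter T φ a y p → ∃ i, (∀ q', T (a q') y ≠ T i y) ∧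
      φ.frac.Adj (T (a p) y) (T i y) := by
    rintro p ⟨t, ht, hpt⟩
    obtain ⟨i, rfl⟩ := (hT y t).1 (((hT y (T (a p) y)).2 ⟨_, rfl⟩).trans
      (φ.frac_le hpt).reachable)
    exact ⟨i, ht, hpt⟩
  have := (hfit y hy).tight (Finset.univ.filter fun p => T (a p) y ∈ S) (by
    intro p q h1 h2 h3
    rw [Finset.mem_filter] at h3 ⊢
    refine ⟨Finset.mem_univ _, hpure p q ?_ h3.2⟩
    have := patchVal_of_mem hfit hdisj hy p q
    exact ⟨fun h => h1 (this.symm.trans h), fun h => h2 (this.symm.trans h)⟩)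
  constructor
  · intro h
    simpa using this p q (key p hp) (key q hq) (by simpa using h)
  · intro h
    simpa using this q p (key q hq) (key p hp) (by simpa using h)

/-- The walk stays on one side of `S` until it first exits the pure window, and it exits from an
outer vertex. -/
theorem patch_exists_outer {S : Set X} {y : X}
    (hpure : IsPure T (patch hfit hdisj) a S y) {u t : X}
    (w : (patch hfit hdisj).frac.Walk u t) (ht : ∀ q, T (a q) y ≠ t) (p : Fin n)
    (hp : T (a p) y = u) :
    ∃ q, IsOuter T φ a y q ∧ (u ∈ S ↔ T (a q) y ∈ S) := by
  induction w generalizing p with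
  | nil => exact absurd hp (ht p)
  | @cons u v t h w ih =>
    by_cases hv : ∃ q, T (a q) y = v
    · obtain ⟨q, rfl⟩ := hv
      obtain ⟨q', h1, h2⟩ := ih ht q rfl
      refine ⟨q', h1, Iff.trans ?_ h2⟩
      subst hp
      exact ⟨hpure p q h, hpure q p h.symm⟩
    · push Not at hv
      exact ⟨p, ⟨v, hv, by rw [hp]; exact (patch_refines hfit hdisj).frac_le h⟩, by rw [hp]⟩

/-- Infinitely many edges may change, so `mono_of_finite_diff` does not apply. Instead `S` is
altered inside windows to a set `S'` with finite boundary for the old weights. -/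
theorem patch_almostOneEnded (hT : ∀ x y, G.Reachable x y ↔ ∃ i, T i x = y)
    (hend : AlmostOneEnded G φ.frac) : AlmostOneEnded G (patch hfit hdisj).frac := by
  classical
  intro x S hS
  set ψ := patch hfit hdisj
  set D := {p : X × X | G.Reachable x p.1 ∧ ψ.frac.Adj p.1 p.2 ∧ p.1 ∈ S ∧ p.2 ∉ S} with hD
  let P : X → Prop := fun v => ∃ y ∈ A, IsPure T ψ a S y ∧ ∃ p, T (a p) y = v
  -- Each pure window goes entirely to the side on which its outer vertices lie; by
  -- `patch_outer_iff` they all lie on the same side.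
  let S' : Set X := {v | (¬ P v ∧ v ∈ S) ∨
    ∃ y ∈ A, IsPure T ψ a S y ∧ (∃ p, T (a p) y = v) ∧ ∃ q, IsOuter T φ a y q ∧ T (a q) y ∈ S}
  have hP : ∀ v, ¬ P v → (v ∈ S' ↔ v ∈ S) := by
    intro v hv
    refine ⟨?_, fun h => Or.inl ⟨hv, h⟩⟩
    rintro (h | ⟨y, hy, h1, h2, -⟩)
    · exact h.2
    · exact absurd ⟨y, hy, h1, h2⟩ hv
  have hwin : ∀ y ∈ A, IsPure T ψ a S y → ∀ p,
      (T (a p) y ∈ S' ↔ ∃ q, IsOuter T φ a y q ∧ T (a q) y ∈ S) := by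
    intro y hy hpure p
    refine ⟨?_, fun h => Or.inr ⟨y, hy, hpure, ⟨p, rfl⟩, h⟩⟩
    rintro (h | ⟨y', hy', -, ⟨p', hp'⟩, h⟩)
    · exact absurd ⟨y, hy, hpure, p, rfl⟩ h.1
    · obtain rfl := hdisj _ hy' _ hy _ _ hp'
      exact h
  have houter : ∀ y ∈ A, IsPure T ψ a S y → ∀ p q, IsOuter T φ a y q →
      (T (a p) y ∈ S' ↔ T (a q) y ∈ S) := by
    intro y hy hpure p q hq
    rw [hwin y hy hpure]
    refine ⟨?_, fun h => ⟨q, hq, h⟩⟩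
    rintro ⟨q', hq', h⟩
    exact (patch_outer_iff hfit hdisj hT hy hpure hq' hq).1 h
  have hsame : ∀ v, {w | ψ.frac.Reachable v w}.Infinite → (v ∈ S' ↔ v ∈ S) := by
    intro v hv
    by_cases hPv : P v
    · obtain ⟨y, hy, hpure, p, rfl⟩ := hPv
      obtain ⟨t, ht, htn⟩ := hv.exists_notMem_finset (Finset.univ.image fun q => T (a q) y)
      obtain ⟨w⟩ := ht
      obtain ⟨q, hq, hqS⟩ := patch_exists_outer hfit hdisj hpure w
        (fun q h => htn (Finset.mem_image.2 ⟨q, Finset.mem_univ _, h⟩)) p rfl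
      rw [houter y hy hpure p q hq, hqS]
    · exact hP v hPv
  -- An impure window contains a boundary edge of `S`, whose first end determines the centre up to
  -- the choice of `T (r p)`; so there are finitely many.
  let bad : Set X := {y | y ∈ A ∧ G.Reachable x y ∧ ¬ IsPure T ψ a S y}
  have hbad : bad.Finite := by
    refine (Set.finite_iUnion fun p => hS.image fun e => T (r p) e.1).subset ?_
    rintro y ⟨hy, hxy, hnp⟩
    simp only [IsPure, not_forall] at hnp
    obtain ⟨p, q, h1, h2, h3⟩ := hnp
    refine Set.mem_iUnion.2 ⟨p, (T (a p) y, T (a q) y), ⟨?_, h1, h2, h3⟩, (hfit y hy).ret p⟩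
    exact hxy.trans ((hT _ _).2 ⟨_, rfl⟩)
  -- An old edge leaving `S'` lies in one of the finitely many impure windows, or in no window. In
  -- the latter case it is unchanged, and `S'` agrees with `S` at its ends.
  have hfin : {p : X × X | G.Reachable x p.1 ∧ φ.frac.Adj p.1 p.2 ∧ p.1 ∈ S' ∧ p.2 ∉ S'}.Finite := by
    refine (hS.union (hbad.biUnion fun y _ => Set.finite_range
      (fun k : Fin n × Fin n => (T (a k.1) y, T (a k.2) y)))).subset ?_
    rintro ⟨u, v⟩ ⟨hxu, huv, hu, hv⟩
    simp only at hxu huv hu hv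
    by_cases hc : ∃ y ∈ A, ∃ p q, T (a p) y = u ∧ T (a q) y = v
    · obtain ⟨y, hy, p, q, rfl, rfl⟩ := hc
      by_cases hpure : IsPure T ψ a S y
      · rw [hwin y hy hpure] at hu hv
        exact absurd hu hv
      · refine Or.inr (Set.mem_biUnion (x := y) ⟨hy, ?_, hpure⟩ ⟨(p, q), rfl⟩)
        exact hxu.trans (Reachable.symm ((hT _ _).2 ⟨_, rfl⟩))
    · have hval : ψ.val u v = φ.val u v :=
        patchVal_of_not fun y hy p q h1 h2 => hc ⟨y, hy, p, q, h1, h2⟩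
      have hside : ∀ u v, φ.frac.Adj u v → (¬ ∃ y ∈ A, ∃ p q, T (a p) y = u ∧ T (a q) y = v) →
          (u ∈ S' ↔ u ∈ S) := by
        intro u v huv hc
        by_cases hPu : P u
        · obtain ⟨y, hy, hpure, p, rfl⟩ := hPu
          exact houter y hy hpure p p ⟨v, fun q hq => hc ⟨y, hy, p, q, rfl, hq⟩, huv⟩
        · exact hP u hPu
      refine Or.inl ⟨hxu, ⟨hval ▸ huv.1, hval ▸ huv.2⟩, (hside u v huv hc).1 hu, fun h => hv ?_⟩
      refine (hside v u huv.symm ?_).2 h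
      rintro ⟨y, hy, p, q, h1, h2⟩
      exact hc ⟨y, hy, q, p, h2, h1⟩
  have hinf : ∀ v, {w | ψ.frac.Reachable v w}.Infinite → {w | φ.frac.Reachable v w}.Infinite :=
    fun v hv => hv.mono fun w hw => Reachable.mono (patch_refines hfit hdisj).frac_le hw
  refine (hend x S' hfin).imp (fun h => h.subset ?_) (fun h => h.subset ?_)
  · rintro v ⟨h1, h2, h3⟩
    exact ⟨h1, hinf v h2, (hsame v h2).2 h3⟩
  · rintro v ⟨h1, h2, h3⟩
    exact ⟨h1, hinf v h2, fun h => h3 ((hsame v h2).1 h)⟩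

end Patch

end Weighting

end SimpleGraph

/-! ### One-endedness of the initial graph -/

namespace SimpleGraph

open Finset

variable {X : Type*}

/-- Deleting the finite set of ends of boundary edges leaves, by local finiteness, finitely many
pieces, only one of them infinite, and `S` contains or misses each piece. -/
theorem IsOneEnded.almostOneEnded {G : SimpleGraph X} [G.LocallyFinite] (hG : G.IsOneEnded) :
    AlmostOneEnded G G := by
  classical
  intro x S hS
  set D := {p : X × X | G.Reachable x p.1 ∧ G.Adj p.1 p.2 ∧ p.1 ∈ S ∧ p.2 ∉ S} with hD
  let C := G.connectedComponentMk x
  let K := C.toSimpleGraph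
  have hF : {v : C | ∃ p ∈ D, (v : X) = p.1 ∨ (v : X) = p.2}.Finite := by
    refine Set.Finite.of_finite_image (f := Subtype.val) ?_ Subtype.val_injective.injOn
    refine ((hS.image Prod.fst).union (hS.image Prod.snd)).subset ?_
    rintro _ ⟨v, ⟨p, hp, h | h⟩, rfl⟩
    · exact Or.inl ⟨p, hp, h.symm⟩
    · exact Or.inr ⟨p, hp, h.symm⟩
  let F : Finset C := hF.toFinset
  have hmemF : ∀ v : C, v ∈ F ↔ ∃ p ∈ D, (v : X) = p.1 ∨ (v : X) = p.2 := fun v => by simp [F]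
  have : K.LocallyFinite := fun v => by
    refine Set.Finite.fintype (Set.Finite.of_finite_image (f := Subtype.val)
      ((G.neighborFinset v).finite_toSet.subset ?_) Subtype.val_injective.injOn)
    rintro _ ⟨w, hw, rfl⟩
    have hw' : G.Adj v w := hw
    simpa using hw'
  have : Fact K.Preconnected := ⟨C.connected_toSimpleGraph.preconnected⟩
  have : Finite (K.induce (F : Set C)ᶜ).ConnectedComponent := K.componentCompl_finite F
  obtain ⟨E, hE, hEu⟩ := hG C (F : Set C) F.finite_toSet
  have hconst : ∀ u v, (K.induce (F : Set C)ᶜ).Reachable u v →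
      ((u : C) : X) ∈ S → ((v : C) : X) ∈ S := by
    rintro u v ⟨w⟩
    induction w with
    | nil => exact id
    | @cons u v t h w ih =>
      intro hu
      refine ih ?_
      by_contra hv
      have hadj : G.Adj (u : C) (v : C) := h
      have hxu : G.Reachable x (u : C) := (ConnectedComponent.exact (u : C).2).symm
      exact u.2 ((hmemF _).2 ⟨((u : C), (v : C)), ⟨hxu, hadj, hu, hv⟩, Or.inl rfl⟩)
  let B : Set X := Subtype.val '' ((F : Set C) ∪
    ⋃ E' ∈ {E' : (K.induce (F : Set C)ᶜ).ConnectedComponent | E' ≠ E}, Subtype.val '' E'.supp)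
  have hB : B.Finite := by
    refine Set.Finite.image _ (F.finite_toSet.union ?_)
    refine Set.Finite.biUnion (Set.toFinite _) fun E' hE' => Set.Finite.image _ ?_
    by_contra h
    exact hE' (hEu E' h)
  obtain ⟨v₀, hv₀⟩ := E.nonempty_supp
  have hout : ∀ v, G.Reachable x v → v ∉ B → (v ∈ S ↔ ((v₀ : C) : X) ∈ S) := by
    intro v hv hvB
    have hvC : v ∈ C.supp := ConnectedComponent.sound hv.symm
    have hvF : (⟨v, hvC⟩ : C) ∉ (F : Set C) := fun h => hvB ⟨_, Or.inl h, rfl⟩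
    have hvE : (K.induce (F : Set C)ᶜ).connectedComponentMk ⟨⟨v, hvC⟩, hvF⟩ = E := by
      by_contra h
      exact hvB ⟨⟨v, hvC⟩, Or.inr (Set.mem_biUnion (x := (K.induce (F : Set C)ᶜ).connectedComponentMk
        ⟨⟨v, hvC⟩, hvF⟩) h ⟨⟨⟨v, hvC⟩, hvF⟩, rfl, rfl⟩), rfl⟩
    have hr := ConnectedComponent.exact (hvE.trans hv₀.symm)
    exact ⟨hconst _ _ hr, hconst _ _ hr.symm⟩
  by_cases h₀ : ((v₀ : C) : X) ∈ S
  · refine Or.inr (hB.subset ?_)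
    rintro v ⟨hv, -, hvS⟩
    by_contra hvB
    exact hvS ((hout v hv hvB).2 h₀)
  · refine Or.inl (hB.subset ?_)
    rintro v ⟨hv, -, hvS⟩
    by_contra hvB
    exact h₀ ((hout v hv hvB).1 hvS)

theorem IsOneEnded.degree_ne_zero {G : SimpleGraph X} [G.LocallyFinite] (hG : G.IsOneEnded)
    (x : X) : G.degree x ≠ 0 := by
  intro h0
  obtain ⟨E, hE, -⟩ := hG (G.connectedComponentMk x) ∅ Set.finite_empty
  have hsub : Subsingleton (G.connectedComponentMk x) := by
    have key : ∀ w : G.connectedComponentMk x, (w : X) = x := by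
      intro w
      obtain ⟨w, hw⟩ := w
      obtain ⟨p⟩ := (ConnectedComponent.exact hw).symm
      cases p with
      | nil => rfl
      | cons h p =>
        have := (G.degree_pos_iff_exists_adj x).2 ⟨_, h⟩
        omega
    exact ⟨fun a b => Subtype.ext ((key a).trans (key b).symm)⟩
  exact hE (Set.toFinite _)

/-! ### Borel enumerations and measurability -/

section Borel

variable [MeasurableSpace X]

/-- The neighbours of a vertex in a Borel graph of constant finite degree can be enumerated by
Borel functions. -/
theorem IsBorel.exists_measurable_neighbors [StandardBorelSpace X] {G : SimpleGraph X}
    [G.LocallyFinite] {d : ℕ} (hG : G.IsBorel) (hreg : G.IsRegularOfDegree d) :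
    ∃ g : Fin d → X → X, (∀ i, Measurable (g i)) ∧ ∀ x y, G.Adj x y ↔ ∃ i, g i x = y := by
  classical
  obtain ⟨e, he⟩ := MeasureTheory.exists_measurableEmbedding_real X
  let N : X → Finset ℝ := fun x => (G.neighborFinset x).image e
  have hN : ∀ x, (N x).card = d := fun x => by
    rw [Finset.card_image_of_injective _ he.injective, card_neighborFinset_eq_degree, hreg x]
  -- Listing neighbours in increasing order of `e` makes the list unique, so the projection of the
  -- Borel set `P` to `X` is a Borel bijection and its inverse is Borel.
  let P : Set (X × (Fin d → X)) :=
    {p | (∀ i, G.Adj p.1 (p.2 i)) ∧ ∀ i j, i < j → e (p.2 i) < e (p.2 j)}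
  have hP : MeasurableSet P := by
    have := he.measurable
    refine measurableSet_setOfPred.2 (Measurable.and (Measurable.forall fun i => ?_)
      (Measurable.forall fun i => Measurable.forall fun j => Measurable.imp measurable_const ?_))
    · exact measurableSet_setOfPred.1 (measurableSet_preimage
        (f := fun p : X × (Fin d → X) => (p.1, p.2 i)) (by fun_prop) hG)
    · exact measurableSet_setOfPred.1 (measurableSet_lt (by fun_prop) (by fun_prop))
  have huniq : ∀ p ∈ P, (fun i => e (p.2 i)) = (N p.1).orderEmbOfFin (hN p.1) := by
    intro p hp
    refine Finset.orderEmbOfFin_unique (hN p.1) (fun i => ?_) (fun i j hij => hp.2 i j hij)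
    exact Finset.mem_image_of_mem e (by simpa using hp.1 i)
  have := hP.standardBorel
  let f : P → X := fun p => p.1.1
  have hf : Measurable f := measurable_fst.comp measurable_subtype_coe
  have hinj : Function.Injective f := by
    rintro ⟨⟨x, y⟩, hp⟩ ⟨⟨x', y'⟩, hp'⟩ h
    obtain rfl : x = x' := h
    have h1 := huniq _ hp
    have h2 := huniq _ hp'
    have : y = y' := funext fun i => he.injective (congrFun (h1.trans h2.symm) i)
    subst this
    rfl
  have hsurj : Function.Surjective f := by
    intro x
    have : ∀ i, ∃ y, G.Adj x y ∧ e y = (N x).orderEmbOfFin (hN x) i := by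
      intro i
      have := Finset.orderEmbOfFin_mem (N x) (hN x) i
      obtain ⟨y, hy, hy'⟩ := Finset.mem_image.1 this
      exact ⟨y, by simpa using hy, hy'⟩
    choose y hy hy' using this
    refine ⟨⟨(x, y), hy, fun i j hij => ?_⟩, rfl⟩
    simp only [hy']
    exact (Finset.orderEmbOfFin _ _).strictMono hij
  choose k hk using hsurj
  have hkm : Measurable k := by
    rw [← (hf.measurableEmbedding hinj).measurable_comp_iff]
    convert measurable_id
    exact funext hk
  refine ⟨fun i x => (k x).1.2 i, fun i => ?_, fun x y => ⟨fun hxy => ?_, ?_⟩⟩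
  · exact (measurable_pi_apply i).comp (measurable_snd.comp (measurable_subtype_coe.comp hkm))
  · have h1 := huniq _ (k x).2
    have h2 : e y ∈ Set.range ((N (k x).1.1).orderEmbOfFin (hN _)) := by
      rw [Finset.range_orderEmbOfFin]
      have : (k x).1.1 = x := hk x
      rw [this]
      exact Finset.mem_image_of_mem e (by simpa using hxy)
    rw [← h1] at h2
    obtain ⟨i, hi⟩ := h2
    exact ⟨i, he.injective hi⟩
  · rintro ⟨i, rfl⟩
    have := (k x).2.1 i
    have hx : (k x).1.1 = x := hk x
    rwa [hx] at this

/-- The connected components of a Borel graph of constant finite degree are enumerated by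
countably many Borel functions. -/
theorem IsBorel.exists_measurable_orbit [StandardBorelSpace X] {G : SimpleGraph X}
    [G.LocallyFinite] {d : ℕ} (hG : G.IsBorel) (hreg : G.IsRegularOfDegree d) :
    ∃ T : List (Fin d) → X → X, (∀ i, Measurable (T i)) ∧
      ∀ x y, G.Reachable x y ↔ ∃ i, T i x = y := by
  obtain ⟨g, hg, hadj⟩ := hG.exists_measurable_neighbors hreg
  refine ⟨fun l x => l.foldl (fun z i => g i z) x, fun l => ?_, fun x y => ⟨?_, ?_⟩⟩
  · induction l with
    | nil => exact measurable_id
    | cons i l ih => exact ih.comp (hg i)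
  · rintro ⟨p⟩
    induction p with
    | nil => exact ⟨[], rfl⟩
    | cons h p ih =>
      obtain ⟨i, rfl⟩ := (hadj _ _).1 h
      obtain ⟨l, hl⟩ := ih
      exact ⟨i :: l, hl⟩
  · rintro ⟨l, rfl⟩
    induction l generalizing x with
    | nil => exact Reachable.refl x
    | cons i l ih => exact (Adj.reachable ((hadj x _).2 ⟨i, rfl⟩)).trans (ih (g i x))

namespace Weighting

variable {G : SimpleGraph X} [G.LocallyFinite] {d : ℕ}

theorem measurable_frac {φ : G.Weighting d} (hφ : Measurable φ.val.uncurry)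
    {Z : Type*} [MeasurableSpace Z] {f g : Z → X} (hf : Measurable f) (hg : Measurable g) :
    Measurable fun z => φ.frac.Adj (f z) (g z) := by
  have h : Measurable fun z => φ.val (f z) (g z) := hφ.comp (hf.prodMk hg)
  have key : ∀ c : ℤ, Measurable fun z => φ.val (f z) (g z) = c := fun c =>
    measurableSet_setOfPred.1 (h (measurableSet_singleton c))
  exact (key 0).not.and (key d).not

theorem measurable_settled {ι : Type*} [Countable ι] {T : ι → X → X}
    (hTm : ∀ i, Measurable (T i)) (hT : ∀ x y, G.Reachable x y ↔ ∃ i, T i x = y)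
    {φ : G.Weighting d} (hφ : Measurable φ.val.uncurry) : Measurable φ.Settled := by
  have : φ.Settled = fun x => ∀ i, ¬ φ.frac.Adj x (T i x) := by
    ext x
    refine ⟨fun h i => h _, fun h y hy => ?_⟩
    obtain ⟨i, rfl⟩ := (hT x y).1 (φ.frac_le hy).reachable
    exact h i hy
  rw [this]
  exact Measurable.forall fun i => (measurable_frac hφ measurable_id (hTm i)).not

variable [MeasurableEq X] {ι : Type*} {T : ι → X → X}
  {φ : G.Weighting d} {n : ℕ} {a r : Fin n → ι} {M : Fin n → Fin n → ℤ} {A : Set X}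

/-- Every quantifier in `Fits` ranges over a countable type. -/
theorem measurable_fits [Countable ι] (hTm : ∀ i, Measurable (T i)) (hφ : Measurable φ.val.uncurry)
    (a r : Fin n → ι) (M : Fin n → Fin n → ℤ) : Measurable (Fits T φ a r M) := by
  have heq : ∀ {f g : X → X}, Measurable f → Measurable g → Measurable fun y => f y = g y :=
    fun hf hg => measurableSet_setOfPred.1 (measurableSet_eq_fun hf hg)
  have hval : ∀ p q, Measurable fun y => φ.val (T (a p) y) (T (a q) y) :=
    fun p q => hφ.comp ((hTm _).prodMk (hTm _))
  have hfr : ∀ i j, Measurable fun y => φ.frac.Adj (T i y) (T j y) :=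
    fun i j => measurable_frac hφ (hTm i) (hTm j)
  have hout : ∀ p, Measurable fun y => ∃ i, (∀ q', T (a q') y ≠ T i y) ∧
      φ.frac.Adj (T (a p) y) (T i y) := fun p =>
    Measurable.exists fun i => (Measurable.forall fun q' => (heq (hTm _) (hTm _)).not).and
      (hfr _ _)
  have h1 : Measurable fun y => ∀ p q, T (a p) y = T (a q) y → p = q :=
    Measurable.forall fun p => Measurable.forall fun q =>
      (heq (hTm _) (hTm _)).imp measurable_const
  have h2 : Measurable fun y => ∀ p, T (r p) (T (a p) y) = y :=
    Measurable.forall fun p => heq ((hTm _).comp (hTm _)) measurable_id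
  have h3 : Measurable fun y => ∀ p q, ¬ φ.frac.Adj (T (a p) y) (T (a q) y) →
      M p q = φ.val (T (a p) y) (T (a q) y) :=
    Measurable.forall fun p => Measurable.forall fun q => (hfr _ _).not.imp
      (measurableSet_setOfPred.1 (measurableSet_eq_fun measurable_const (hval p q)))
  have h4 : Measurable fun y => ∀ p, ∑ q, M p q = ∑ q, φ.val (T (a p) y) (T (a q) y) :=
    Measurable.forall fun p => measurableSet_setOfPred.1 (measurableSet_eq_fun measurable_const
      (Finset.measurable_sum _ fun q _ => hval p q))
  have h5 : Measurable fun y => ∃ p, T (a p) y = y ∧ (∀ q, M p q = 0 ∨ M p q = d) ∧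
      ∀ i, φ.frac.Adj y (T i y) → ∃ q, T (a q) y = T i y :=
    Measurable.exists fun p => (heq (hTm _) measurable_id).and (measurable_const.and
      (Measurable.forall fun i => (measurable_frac hφ measurable_id (hTm i)).imp
        (Measurable.exists fun q => heq (hTm _) (hTm _))))
  have h6 : Measurable fun y => ∀ S : Finset (Fin n),
      (∀ p q, M p q ≠ 0 → M p q ≠ d → p ∈ S → q ∈ S) → ∀ p q,
      (∃ i, (∀ q', T (a q') y ≠ T i y) ∧ φ.frac.Adj (T (a p) y) (T i y)) →
      (∃ i, (∀ q', T (a q') y ≠ T i y) ∧ φ.frac.Adj (T (a q) y) (T i y)) → p ∈ S → q ∈ S :=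
    Measurable.forall fun S => Measurable.imp measurable_const <|
      Measurable.forall fun p => Measurable.forall fun q =>
        (hout p).imp ((hout q).imp measurable_const)
  convert h1.and (h2.and ((measurable_const (a := ∀ p q, M p q = M q p)).and
    ((measurable_const (a := ∀ p q, 0 ≤ M p q)).and (h3.and (h4.and (h5.and h6)))))) using 1
  ext y
  exact ⟨fun ⟨k1, k2, k3, k4, k5, k6, k7, k8⟩ => ⟨k1, k2, k3, k4, k5, k6, k7, k8⟩,
    fun ⟨k1, k2, k3, k4, k5, k6, k7, k8⟩ => ⟨k1, k2, k3, k4, k5, k6, k7, k8⟩⟩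

theorem measurable_patch (hTm : ∀ i, Measurable (T i)) (hφ : Measurable φ.val.uncurry)
    (hA : MeasurableSet A) (hfit : ∀ y ∈ A, Fits T φ a r M y)
    (hdisj : ∀ y ∈ A, ∀ y' ∈ A, ∀ p q, T (a p) y = T (a q) y' → y = y') :
    Measurable (patch hfit hdisj).val.uncurry := by
  -- The return maps `T (r p)` replace the quantifier over centres in `A`, keeping the condition
  -- Borel.
  let Q : Fin n → Fin n → X × X → Prop := fun p q z => T (r p) z.1 ∈ A ∧
    T (a p) (T (r p) z.1) = z.1 ∧ T (a q) (T (r p) z.1) = z.2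
  have hQ : ∀ p q, Measurable (Q p q) := by
    intro p q
    have h1 := hTm (r p)
    have h2 := hTm (a p)
    have h3 := hTm (a q)
    refine Measurable.and (measurableSet_setOfPred.1 (measurableSet_preimage
      (h1.comp measurable_fst) hA)) (Measurable.and ?_ ?_)
    · exact measurableSet_setOfPred.1 (measurableSet_eq_fun (by fun_prop) (by fun_prop))
    · exact measurableSet_setOfPred.1 (measurableSet_eq_fun (by fun_prop) (by fun_prop))
  refine measurable_to_countable' fun c => ?_
  have hset : (patch hfit hdisj).val.uncurry ⁻¹' {c} =
      {z | (∃ p q, Q p q z ∧ M p q = c) ∨ ((∀ p q, ¬ Q p q z) ∧ φ.val z.1 z.2 = c)} := by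
    ext ⟨u, v⟩
    change patchVal T φ a M A u v = c ↔ _
    by_cases hw : ∃ y ∈ A, ∃ p q, T (a p) y = u ∧ T (a q) y = v
    · obtain ⟨y, hy, p, q, rfl, rfl⟩ := hw
      rw [patchVal_of_mem hfit hdisj hy]
      have hpq : Q p q (T (a p) y, T (a q) y) := by
        simp only [Q, (hfit y hy).ret]
        exact ⟨hy, trivial, trivial⟩
      constructor
      · exact fun h => Or.inl ⟨p, q, hpq, h⟩
      · rintro (⟨p', q', ⟨h1, h2, h3⟩, h⟩ | ⟨h, -⟩)
        · simp only at h1 h2 h3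
          have hy' := hdisj _ h1 _ hy _ _ h2
          rw [hy'] at h2 h3
          rw [← h, (hfit y hy).inj _ _ h2, (hfit y hy).inj _ _ h3]
        · exact absurd hpq (h p q)
    · rw [patchVal_of_not fun y hy p q h1 h2 => hw ⟨y, hy, p, q, h1, h2⟩]
      have hn : ∀ p q, ¬ Q p q (u, v) := fun p q h => hw ⟨_, h.1, p, q, h.2.1, h.2.2⟩
      constructor
      · exact fun h => Or.inr ⟨hn, h⟩
      · rintro (⟨p, q, h, -⟩ | ⟨-, h⟩)
        · exact absurd h (hn p q)
        · exact h
  rw [hset]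
  refine measurableSet_setOfPred.2 (Measurable.or ?_ (Measurable.and ?_ ?_))
  · exact Measurable.exists fun p => Measurable.exists fun q => (hQ p q).and measurable_const
  · exact Measurable.forall fun p => Measurable.forall fun q => (hQ p q).not
  · exact measurableSet_setOfPred.1 (hφ (measurableSet_singleton c))

end Weighting

end Borel

end SimpleGraph

/-! ### Baire category and iterated refinement -/

open Set TopologicalSpace

/-- A Borel set that is nonmeagre in every set of a countable basis is comeagre. -/
theorem mem_residual_of_not_isMeagre_inter {X : Type*} [TopologicalSpace X] [MeasurableSpace X]
    [BorelSpace X] {b : Set (Set X)} (hb : IsTopologicalBasis b) {R : Set X} (hR : MeasurableSet R)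
    (h : ∀ U ∈ b, U.Nonempty → ¬ IsMeagre (U ∩ R)) : R ∈ residual X := by
  -- By the Baire property `Rᶜ` is open modulo a meagre set; a nonempty basic set inside that open
  -- set would meet `R` in a meagre set.
  obtain ⟨O, hO, hRO⟩ := hR.compl.residualEq_isOpen
  have hempty : O = ∅ := by
    by_contra hne
    obtain ⟨x, hx⟩ := nonempty_iff_ne_empty.2 hne
    obtain ⟨U, hU, hxU, hUO⟩ := hb.exists_subset_of_mem_open hx hO
    refine h U hU ⟨x, hxU⟩ ?_
    filter_upwards [hRO.mem_iff] with z hz hz'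
    exact hz.2 (hUO hz'.1) hz'.2
  subst hempty
  filter_upwards [hRO.mem_iff] with z hz
  by_contra hn
  exact hz.1 hn

namespace SimpleGraph

variable {X : Type*} {G : SimpleGraph X} [G.LocallyFinite] {d : ℕ}

namespace Weighting

/-- The weighting that gives weight one to every edge of a regular graph. -/
noncomputable def one (hreg : G.IsRegularOfDegree d) : G.Weighting d := by
  classical
  exact
  { val := fun a b => if G.Adj a b then 1 else 0
    symm := fun a b => if_congr (G.adj_comm a b) rfl rfl
    adj_of_ne := fun a b h => by
      by_contra hn
      exact h (if_neg hn)
    nonneg := fun a b => by split_ifs <;> simp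
    sum_eq := fun a => by
      rw [Finset.sum_congr rfl fun b hb => if_pos ((G.mem_neighborFinset a b).1 hb)]
      simp [hreg a] }

theorem one_val (hreg : G.IsRegularOfDegree d) {a b : X} (h : G.Adj a b) :
    (one hreg).val a b = 1 := by
  classical
  exact if_pos h

/-- For `d = 1` no edge is fractional and no component is infinite; otherwise all edges are
fractional. -/
theorem almostOneEnded_one (hreg : G.IsRegularOfDegree d) (hG : G.IsOneEnded) :
    AlmostOneEnded G (one hreg).frac := by
  by_cases hd : d = 1
  · have hbot : (one hreg).frac = ⊥ := by
      ext a b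
      simp only [bot_adj, iff_false]
      intro h
      exact h.2 (by rw [one_val hreg ((one hreg).frac_le h), hd]; rfl)
    have hfin : ∀ v, ¬ {w | (one hreg).frac.Reachable v w}.Infinite := by
      intro v h
      refine h ((finite_singleton v).subset fun w hw => ?_)
      rw [hbot] at hw
      exact (reachable_bot.1 hw).symm
    intro x S _
    refine Or.inl (finite_empty.subset ?_)
    rintro v ⟨-, h, -⟩
    exact hfin v h
  · have : (one hreg).frac = G := by
      refine le_antisymm (one hreg).frac_le fun a b h => ?_
      refine ⟨by rw [one_val hreg h]; exact one_ne_zero, ?_⟩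
      rw [one_val hreg h]
      exact_mod_cast Ne.symm hd
    rw [this]
    exact hG.almostOneEnded

theorem measurable_one [MeasurableSpace X] (hG : G.IsBorel) (hreg : G.IsRegularOfDegree d) :
    Measurable (one hreg).val.uncurry := by
  classical
  exact Measurable.ite (p := fun z : X × X => G.Adj z.1 z.2) hG measurable_const measurable_const

theorem existsUnique_val_eq (φ : G.Weighting d) (hd : d ≠ 0) {x : X} (hx : φ.Settled x) :
    ∃! y, φ.val x y = d := by
  have hval : ∀ y, φ.val x y = 0 ∨ φ.val x y = d := fun y => by
    by_contra hcon
    exact hx y (not_or.1 hcon)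
  obtain ⟨y, hy⟩ : ∃ y, φ.val x y = d := by
    by_contra hcon
    push Not at hcon
    have := φ.sum_eq x
    rw [Finset.sum_eq_zero fun y _ => (hval y).resolve_right (hcon y)] at this
    exact hd (by exact_mod_cast this.symm)
  refine ⟨y, hy, fun z hz => ?_⟩
  classical
  by_contra hne
  have hmem : ∀ w, φ.val x w = d → w ∈ G.neighborFinset x := fun w hw => by
    rw [mem_neighborFinset]
    exact φ.adj_of_ne x w (by rw [hw]; exact_mod_cast hd)
  have h1 := Finset.add_sum_erase _ (fun w => φ.val x w) (hmem y hy)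
  have h2 := Finset.single_le_sum (f := fun w => φ.val x w)
    (s := (G.neighborFinset x).erase y) (fun w _ => φ.nonneg x w) (a := z)
    (Finset.mem_erase.2 ⟨hne, hmem z hz⟩)
  have h3 := φ.sum_eq x
  simp only [hy, hz] at h1 h2
  omega

variable [TopologicalSpace X] [PolishSpace X] [MeasurableSpace X] [BorelSpace X]
  {ι : Type*} [Countable ι] {T : ι → X → X}

/-- A Borel weighting can be refined so as to settle `T i x` for nonmeagrely many `x` in any
given open set. -/
theorem exists_refines_not_isMeagre (hTm : ∀ i, Measurable (T i))
    (hT : ∀ x y, G.Reachable x y ↔ ∃ i, T i x = y)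
    {sgn : X → ℤ} (hsgn : ∀ a, sgn a = 1 ∨ sgn a = -1)
    (hadj : ∀ a b, G.Adj a b → sgn b = - sgn a) {φ : G.Weighting d}
    (hφ : Measurable φ.val.uncurry) (hend : AlmostOneEnded G φ.frac) (i : ι) {U : Set X}
    (hU : IsOpen U) (hne : U.Nonempty) :
    ∃ ψ : G.Weighting d, Measurable ψ.val.uncurry ∧ AlmostOneEnded G ψ.frac ∧ ψ.Refines φ ∧
      ¬ IsMeagre (U ∩ {x | ψ.Settled (T i x)}) := by
  obtain ⟨b, hbc, -, hb⟩ := exists_countable_basis X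
  have := hbc.to_subtype
  let Code := (n : ℕ) × (Fin n → ι) × (Fin n → ι) × (Fin n → Fin n → ℤ)
  -- The last clause separates centres: if the windows of two points of `A c` meet, a return map
  -- sends a point of the first window to the second centre, which lies in the basic set and so
  -- equals the first.
  let A : Code × b → Set X := fun c =>
    {y | Fits T φ c.1.2.1 c.1.2.2.1 c.1.2.2.2 y ∧ y ∈ (c.2 : Set X) ∧
      ∀ p q, T (c.1.2.2.1 q) (T (c.1.2.1 p) y) = y ∨
        T (c.1.2.2.1 q) (T (c.1.2.1 p) y) ∉ (c.2 : Set X)}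
  have hA : ∀ c, MeasurableSet (A c) := by
    intro c
    have hB := (hb.isOpen c.2.2).measurableSet
    refine measurableSet_setOfPred.2 ((measurable_fits hTm hφ _ _ _).and
      ((measurableSet_setOfPred.1 hB).and (Measurable.forall fun p => Measurable.forall fun q =>
        Measurable.or ?_ (Measurable.not ?_))))
    · exact measurableSet_setOfPred.1 (measurableSet_eq_fun ((hTm _).comp (hTm _)) measurable_id)
    · exact measurableSet_setOfPred.1 (measurableSet_preimage ((hTm _).comp (hTm _)) hB)
  have hcover : U ⊆ ⋃ c, U ∩ {x | T i x ∈ A c} := by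
    intro x hx
    obtain ⟨n, a, r, M, hfit⟩ := φ.exists_fits hT hsgn hadj hend (T i x)
    let Z : Set X := (range fun k : Fin n × Fin n => T (r k.2) (T (a k.1) (T i x))) \ {T i x}
    have hZ : IsOpen Zᶜ := ((finite_range _).sdiff).isClosed.isOpen_compl
    obtain ⟨B, hB, hxB, hBZ⟩ := hb.exists_subset_of_mem_open
      (show T i x ∈ Zᶜ from fun h => h.2 rfl) hZ
    refine mem_iUnion.2 ⟨(⟨n, a, r, M⟩, ⟨B, hB⟩), hx, hfit, hxB, fun p q => ?_⟩
    by_contra hcon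
    push Not at hcon
    exact hBZ hcon.2 ⟨⟨(p, q), rfl⟩, hcon.1⟩
  obtain ⟨c, hc⟩ : ∃ c, ¬ IsMeagre (U ∩ {x | T i x ∈ A c}) := by
    by_contra hcon
    push Not at hcon
    exact not_isMeagre_of_isOpen hU hne ((isMeagre_iUnion hcon).mono hcover)
  have hfit : ∀ y ∈ A c, Fits T φ c.1.2.1 c.1.2.2.1 c.1.2.2.2 y := fun y hy => hy.1
  have hdisj : ∀ y ∈ A c, ∀ y' ∈ A c, ∀ p q,
      T (c.1.2.1 p) y = T (c.1.2.1 q) y' → y = y' := by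
    intro y hy y' hy' p q h
    have h' : T (c.1.2.2.1 q) (T (c.1.2.1 p) y) = y' := by rw [h, hy'.1.ret]
    rcases hy.2.2 p q with h1 | h1
    · exact h1.symm.trans h'
    · exact absurd (h' ▸ hy'.2.1) h1
  refine ⟨patch hfit hdisj, measurable_patch hTm hφ (hA c) hfit hdisj,
    patch_almostOneEnded hfit hdisj hT hend, patch_refines hfit hdisj, fun h => hc (h.mono ?_)⟩
  rintro x ⟨hx, hxA⟩
  exact ⟨hx, patch_settled hfit hdisj hT hxA⟩

/-- A decreasing sequence of Borel refinements that settles every vertex of almost every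
component. -/
theorem exists_seq_settled (hTm : ∀ i, Measurable (T i))
    (hT : ∀ x y, G.Reachable x y ↔ ∃ i, T i x = y)
    {sgn : X → ℤ} (hsgn : ∀ a, sgn a = 1 ∨ sgn a = -1)
    (hadj : ∀ a b, G.Adj a b → sgn b = - sgn a) {φ : G.Weighting d}
    (hφ : Measurable φ.val.uncurry) (hend : AlmostOneEnded G φ.frac) :
    ∃ Φ : ℕ → G.Weighting d, (∀ n, Measurable (Φ n).val.uncurry) ∧
      (∀ n m, n ≤ m → (Φ m).Refines (Φ n)) ∧
      ∀ i, {x | ∃ n, (Φ n).Settled (T i x)} ∈ residual X := by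
  obtain ⟨b, hbc, hbe, hb⟩ := exists_countable_basis X
  have := hbc.to_subtype
  -- `Option` supplies an idle task, needed when `ι × b` is empty.
  obtain ⟨t, ht⟩ := exists_surjective_nat (Option (ι × b))
  let State := {φ : G.Weighting d // Measurable φ.val.uncurry ∧ AlmostOneEnded G φ.frac}
  have step : ∀ (o : Option (ι × b)) (φ : State), ∃ ψ : State, ψ.1.Refines φ.1 ∧
      ∀ k ∈ o, ¬ IsMeagre ((k.2 : Set X) ∩ {x | ψ.1.Settled (T k.1 x)}) := by
    rintro (_ | ⟨i, U⟩) φ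
    · exact ⟨φ, Refines.refl _, by simp⟩
    · obtain ⟨ψ, h1, h2, h3, h4⟩ := exists_refines_not_isMeagre hTm hT hsgn hadj φ.2.1 φ.2.2 i
        (hb.isOpen U.2) (nonempty_iff_ne_empty.2 fun h => hbe (h ▸ U.2))
      refine ⟨⟨ψ, h1, h2⟩, h3, fun k hk => ?_⟩
      obtain rfl : (i, U) = k := Option.some_injective _ hk
      exact h4
  choose next href hnext using step
  let Φ : ℕ → State := fun n => Nat.rec ⟨φ, hφ, hend⟩ (fun m ψ => next (t m) ψ) n
  have hΦ : ∀ n, Φ (n + 1) = next (t n) (Φ n) := fun n => rfl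
  refine ⟨fun n => (Φ n).1, fun n => (Φ n).2.1, fun n m hnm => ?_, fun i => ?_⟩
  · induction m, hnm using Nat.le_induction with
    | base => exact Refines.refl _
    | succ m _ ih => exact (hΦ m ▸ href (t m) (Φ m)).trans ih
  · refine mem_residual_of_not_isMeagre_inter hb ?_ fun U hU _ hmeagre => ?_
    · refine measurableSet_setOfPred.2 (Measurable.exists fun n => ?_)
      exact (measurable_settled hTm hT (Φ n).2.1).comp (hTm i)
    · obtain ⟨n, hn⟩ := ht (some (i, ⟨U, hU⟩))
      refine hnext (t n) (Φ n) (i, ⟨U, hU⟩) hn (hmeagre.mono ?_)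
      rintro x ⟨hxU, hx⟩
      exact ⟨hxU, n + 1, hx⟩

end Weighting

end SimpleGraph

/-! ### The matching in the limit -/

theorem theorem1p2 {X : Type*} [TopologicalSpace X] [PolishSpace X] [MeasurableSpace X]
    [BorelSpace X] (G : SimpleGraph X) [G.LocallyFinite] (d : ℕ)
    (hBorel : G.IsBorel) (hbip : G.IsBipartite) (hend : G.IsOneEnded)
    (hreg : G.IsRegularOfDegree d) :
    ∃ Y : Set X, MeasurableSet Y ∧ Y ∈ residual X ∧ G.IsInvariantSet Y ∧
      (G.induce Y).HasBorelPerfectMatching := by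
  obtain ⟨T, hTm, hT⟩ := hBorel.exists_measurable_orbit hreg
  obtain ⟨col⟩ := hbip
  let sgn : X → ℤ := fun x => if col x = 0 then 1 else -1
  have hsgn : ∀ x, sgn x = 1 ∨ sgn x = -1 := fun x => by
    simp only [sgn]
    split_ifs <;> simp
  have hadj : ∀ x y, G.Adj x y → sgn y = - sgn x := fun x y hxy => by
    have hne := col.valid hxy
    simp only [sgn]
    split_ifs with h1 h2 h2
    · exact absurd (h2.trans h1.symm) hne
    · simp
    · simp
    · exact absurd (by omega) hne
  obtain ⟨Φ, hΦm, hΦr, hΦs⟩ := SimpleGraph.Weighting.exists_seq_settled hTm hT hsgn hadj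
    (SimpleGraph.Weighting.measurable_one hBorel hreg) (SimpleGraph.Weighting.almostOneEnded_one hreg hend)
  -- Stated per point because `d = 0` is possible when `X` is empty.
  have hd : ∀ _ : X, d ≠ 0 := fun x => hreg x ▸ hend.degree_ne_zero x
  have hstay : ∀ n m, n ≤ m → ∀ x y, (Φ n).val x y = d → (Φ m).val x y = d := fun n m hnm x y h =>
    (hΦr n m hnm x y fun h' => h'.2 h).trans h
  let Y : Set X := {x | ∀ i, ∃ n, (Φ n).Settled (T i x)}
  have hYself : ∀ x ∈ Y, ∃ n, (Φ n).Settled x := by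
    intro x hx
    obtain ⟨i, hi⟩ := (hT x x).1 (SimpleGraph.Reachable.refl x)
    simpa [hi] using hx i
  have hYinv : G.IsInvariantSet Y := by
    intro x y hxy hx i
    obtain ⟨j, hj⟩ := (hT x (T i y)).1 (hxy.trans ((hT y _).2 ⟨i, rfl⟩))
    rw [← hj]
    exact hx j
  refine ⟨Y, ?_, ?_, hYinv, ?_⟩
  · refine measurableSet_setOfPred.2 (Measurable.forall fun i => Measurable.exists fun n => ?_)
    exact (SimpleGraph.Weighting.measurable_settled hTm hT (hΦm n)).comp (hTm i)
  · have : Y = ⋂ i, {x | ∃ n, (Φ n).Settled (T i x)} := by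
      ext x
      simp [Y]
    rw [this]
    exact countable_iInter_mem.2 hΦs
  · have hG : ∀ x y n, (Φ n).val x y = d → G.Adj x y := fun x y n h =>
      (Φ n).adj_of_ne x y (by rw [h]; exact_mod_cast hd x)
    -- Weight `d` persists under refinement, so the edges that ever reach it form an increasing
    -- union.
    let M : (G.induce Y).Subgraph :=
      { verts := univ
        Adj := fun x y => ∃ n, (Φ n).val x y = d
        adj_sub := fun {x y} ⟨n, h⟩ => hG x y n h
        edge_vert := fun _ => mem_univ _
        symm := ⟨fun x y ⟨n, h⟩ => ⟨n, ((Φ n).symm y x).trans h⟩⟩ }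
    refine ⟨M, ⟨?_, fun x => mem_univ x⟩, ?_⟩
    · intro x _
      obtain ⟨n, hn⟩ := hYself x x.2
      obtain ⟨y, hy, -⟩ := (Φ n).existsUnique_val_eq (hd x) hn
      refine ⟨⟨y, hYinv (hG x y n hy).reachable x.2⟩, ⟨n, hy⟩, ?_⟩
      rintro z ⟨m, hm⟩
      have hs := SimpleGraph.Weighting.Settled.of_refines (hΦr n (max n m) (le_max_left _ _)) hn
      exact Subtype.ext (((Φ (max n m)).existsUnique_val_eq (hd x) hs).unique
        (hstay m _ (le_max_right _ _) _ _ hm) (hstay n _ (le_max_left _ _) _ _ hy))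
    · refine measurableSet_setOfPred.2 (Measurable.exists fun n => ?_)
      refine measurableSet_setOfPred.1 (measurableSet_preimage
        (f := fun p : Y × Y => (Φ n).val p.1 p.2) ?_ (measurableSet_singleton (d : ℤ)))
      exact (hΦm n).comp ((measurable_subtype_coe.comp measurable_fst).prodMk
        (measurable_subtype_coe.comp measurable_snd))
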